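/- Let $q$ be a prime power, let $b,b',r,\delta\ge 1$ be integers, and put $n=q^b-1$, $a=r+\delta-1$. Assume that $a=q^{b'}-1$ and $a\mid n$, and put $m=n/a$. Let $\alpha$ be a primitive element of $\mathbb F_{q^b}$, $\beta=\alpha^m$ and $\lambda=\alpha^s$ with $\gcd(s,m)=1$. Let $\mathcal C$ be the linear code of length $n$ over $\mathbb F_{q^b}$ (the MR code of Gopi et al. with two global parity checks), with coordinates indexed by $\mathbb Z_n=\{0,1,\dots,n-1\}$, that consists of all $c\in\mathbb F_{q^b}^n$ such that $$\sum_{x=0}^{a-1}\beta^{jx}c_{xm+i}=0\quad(0\le i\le m-1,\ 1\le j\le\delta-1),$$ $$\sum_{i=0}^{m-1}\sum_{x=0}^{a-1}\lambda^{i}c_{xm+i}=0,\qquad \sum_{i=0}^{m-1}\sum_{x=0}^{a-1}\beta^{\delta x}c_{xm+i}=0 .$$ Write $k=\dim\mathcal C=ur+v$ with integers $u,v$ and $0<v\le r$, and assume that $u\ge 2(r-v+1)$. Assume moreover that $a=4$ or $\gcd(a,\varphi(a))=1$, where $\varphi$ is Euler's totient function, and that one of the following holds: 1. $\delta\ge 4$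 and $r\ge 5$; 2. $\delta=3$ and $r\ge 4$; 3. $\delta=2$ and $r\ge 3$ is odd. If there is a permutation $\ell$ of $\mathbb Z_n$ such that the code $\mathcal C_\ell=\{(c_{\ell(0)},c_{\ell(1)},\dots,c_{\ell(n-1)}) : c\in\mathcal C\}$ is cyclic (that is, closed under $(c_0,c_1,\dots,c_{n-1})\mapsto(c_{n-1},c_0,\dots,c_{n-2})$), then $\gcd(m,a)\mid\delta$. -/

import Mathlib

namespace MRCode

/-- The parity-check matrix of the code of Gopi et al., with columns indexed by `ZMod n` and with
`β = α ^ m`, `lam = α ^ s`. The column at position `x * m + i` (where `0 ≤ i < m`, so that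
`i = c.val % m` and `x = c.val / m`) has, among the local rows, the entries
`β ^ x, β ^ (2 * x), …, β ^ ((δ - 1) * x)` in the `i`-th group of `δ - 1` rows and zeros in the other
groups; its entries in the two global rows are `lam ^ i` and `β ^ (δ * x)`. -/
def parityCheck {F : Type*} [Field F] (n m δ s : ℕ) (α : F) :
    Matrix ((Fin m × Fin (δ - 1)) ⊕ Fin 2) (ZMod n) F :=
  fun row c =>
    match row with
    | Sum.inl (i, t) => if c.val % m = i.val then (α ^ m) ^ ((t.val + 1) * (c.val / m)) else 0
    | Sum.inr 0 => (α ^ s) ^ (c.val % m)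
    | Sum.inr 1 => (α ^ m) ^ (δ * (c.val / m))

/-- The code of Gopi et al.: all vectors `c` such that `H c = 0` for the above matrix `H`. -/
def code {F : Type*} [Field F] (n m δ s : ℕ) [NeZero n] (α : F) : Submodule F (ZMod n → F) :=
  LinearMap.ker (parityCheck n m δ s α).mulVecLin

/-- The permuted code `{(c (ℓ 0), …, c (ℓ (n - 1))) : c ∈ C}`. -/
def permute {F : Type*} [Field F] {n : ℕ} (C : Submodule F (ZMod n → F))
    (l : Equiv.Perm (ZMod n)) : Submodule F (ZMod n → F) :=
  C.map (LinearMap.funLeft F F l)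

/-- A linear code is cyclic if it is closed under the cyclic shift by one place,
`(c 0, c 1, …, c (n - 1)) ↦ (c (n - 1), c 0, …, c (n - 2))`. -/
def IsCyclicCode {F : Type*} [Field F] {n : ℕ} (C : Submodule F (ZMod n → F)) : Prop :=
  ∀ c ∈ C, (fun i : ZMod n => c (i - 1)) ∈ C

end MRCode

/-! The dual code consists of the words equal to `A * μ i + B * y ^ δ + y * q_i(y)` on block `i`,
where `y` runs over the `a`-th roots of unity, `A` and `B` are common to all blocks and `deg q_i < δ
- 1`. A cyclic numbering makes the dual invariant under a regular action of `ZMod n`. Each shift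
permutes the blocks: two positions share a block exactly when both lie in the support of some dual
word of weight at most `r + 1` (`blk_eq_of_card_support_le`, `exists_dualWord_of_blk_eq`). Between
blocks it preserves the span of `y, …, y ^ (δ - 1)` in both directions, which forces `y ↦ c_i * y`
(`scaling_of_preserves_span`). Since `B` is global, `c_i ^ δ` does not depend on `i`
(`exists_scaling_pow`), so `k` unit shifts multiply `Y ^ δ` by `c ^ (δ * k)`. Some shift by `k`
takes the point `1` of a block to the point `β` of the same block. The stabilizer of a block has
order `a`, so `m ∣ k`. Then `β ^ δ = c ^ (δ * k)` with `c` a power of `β`; raising to the power `a /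
gcd(m, a)` gives `1` on the right, whence `gcd(m, a) ∣ δ`. -/

/-! ### Polynomial functions on the `a`-th roots of unity. -/

open Polynomial in
theorem sum_nthRootsFinset_pow_eq_zero {F : Type*} [Field F] {a : ℕ} {β : F}
    (hβ : IsPrimitiveRoot β a) (ha : 0 < a) {e : ℕ} (he : ¬ a ∣ e) :
    ∑ y ∈ nthRootsFinset a (1 : F), y ^ e = 0 := by
  have hβa : β ^ a = 1 := hβ.pow_eq_one
  have hβ0 : β ≠ 0 := hβ.ne_zero ha.ne'
  have h1 : ∑ y ∈ nthRootsFinset a (1 : F), (β * y) ^ e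
      = ∑ y ∈ nthRootsFinset a (1 : F), y ^ e := by
    refine Finset.sum_nbij' (fun y => β * y) (fun y => β⁻¹ * y) ?_ ?_ ?_ ?_ ?_
    · intro y hy
      rw [mem_nthRootsFinset ha] at hy ⊢
      rw [mul_pow, hβa, hy, one_mul]
    · intro y hy
      rw [mem_nthRootsFinset ha] at hy ⊢
      rw [mul_pow, inv_pow, hβa, hy, inv_one, one_mul]
    · intro y _; field_simp
    · intro y _; field_simp
    · intro y _; rfl
  simp_rw [mul_pow] at h1
  rw [← Finset.mul_sum] at h1
  have h2 : (β ^ e - 1) * ∑ y ∈ nthRootsFinset a (1 : F), y ^ e = 0 := by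
    rw [sub_mul, h1, one_mul, sub_self]
  refine (mul_eq_zero.mp h2).resolve_left fun h => he ?_
  exact (hβ.pow_eq_one_iff_dvd e).mp (sub_eq_zero.mp h)

open Polynomial in
/-- The discrete Fourier transform on the `a`-th roots of unity recovers the coefficients. -/
theorem sum_nthRootsFinset_eval_mul_pow {F : Type*} [Field F] {a : ℕ} {β : F}
    (hβ : IsPrimitiveRoot β a) (ha : 0 < a) {P : F[X]} (hP : P.natDegree < a) {t : ℕ}
    (ht0 : 0 < t) (hta : t < a) :
    ∑ y ∈ nthRootsFinset a (1 : F), P.eval y * y ^ t = a * P.coeff (a - t) := by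
  have h1 : ∀ y : F, P.eval y * y ^ t = ∑ k ∈ Finset.range a, P.coeff k * y ^ (k + t) := by
    intro y
    rw [eval_eq_sum_range' hP, Finset.sum_mul]
    exact Finset.sum_congr rfl fun k _ => by rw [pow_add, mul_assoc]
  simp_rw [h1]
  rw [Finset.sum_comm]
  simp_rw [← Finset.mul_sum]
  rw [Finset.sum_eq_single (a - t)]
  · have h2 : ∀ y ∈ nthRootsFinset a (1 : F), y ^ (a - t + t) = 1 := by
      intro y hy
      rw [Nat.sub_add_cancel hta.le]
      exact (mem_nthRootsFinset ha 1).mp hy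
    rw [Finset.sum_congr rfl h2]
    simp [hβ.card_nthRootsFinset, mul_comm]
  · intro k hk hne
    rw [sum_nthRootsFinset_pow_eq_zero hβ ha, mul_zero]
    rintro ⟨c, hc⟩
    have hk' := Finset.mem_range.mp hk
    have : c = 1 := by
      have h3 : c < 2 := by
        by_contra h
        have : a * 2 ≤ a * c := Nat.mul_le_mul_left a (not_lt.mp h)
        omega
      have h4 : c ≠ 0 := by rintro rfl; omega
      omega
    subst this
    omega
  · intro h
    exact absurd (Finset.mem_range.mpr (by omega)) h

open Polynomial in
theorem eq_of_eval_eq_on_nthRootsFinset {F : Type*} [Field F] {a : ℕ} {β : F}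
    (hβ : IsPrimitiveRoot β a) {P Q : F[X]} (hP : P.natDegree < a) (hQ : Q.natDegree < a)
    (h : ∀ y ∈ nthRootsFinset a (1 : F), P.eval y = Q.eval y) : P = Q := by
  refine Polynomial.eq_of_degree_sub_lt_of_eval_finset_eq (nthRootsFinset a (1 : F)) ?_ h
  rw [hβ.card_nthRootsFinset]
  have hPQ : (P - Q).natDegree < a := (natDegree_sub_le P Q).trans_lt (max_lt hP hQ)
  exact (degree_le_natDegree).trans_lt (by exact_mod_cast hPQ)

open Polynomial in
/-- If the first `N` powers of a function on the `a`-th roots of unity are all represented by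
polynomials of degree at most `N < a / 2`, then the function is affine. -/
theorem natDegree_le_one_of_pow_representable {F : Type*} [Field F] {a : ℕ} {β : F}
    (hβ : IsPrimitiveRoot β a) {N : ℕ} (hNa : 2 * N < a) {g : F[X]} (hg : g.natDegree ≤ N)
    (hpow : ∀ j, 1 ≤ j → j ≤ N → ∃ P : F[X], P.natDegree ≤ N ∧
      ∀ y ∈ nthRootsFinset a (1 : F), g.eval y ^ j = P.eval y) : g.natDegree ≤ 1 := by
  by_contra! hd
  set d := g.natDegree with hdd
  have hN : N / d ≤ N / 2 := Nat.div_le_div_left hd (by norm_num)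
  have h1 : d * (N / d) ≤ N := Nat.mul_div_le N d
  have h2 : N < d * (N / d + 1) := Nat.lt_mul_div_succ N (by omega)
  -- This is the first power of `g` whose degree exceeds `N`. The degree is at most `N + d ≤ 2 * N <
  -- a`, so no reduction modulo `y ^ a - 1` can hide it.
  obtain ⟨P, hP, hPe⟩ := hpow (N / d + 1) (Nat.le_add_left 1 _) (by omega)
  have hdeg : (g ^ (N / d + 1)).natDegree = d * (N / d + 1) := by
    rw [natDegree_pow, mul_comm]
  have h3 : d * (N / d + 1) = d * (N / d) + d := by ring
  have heq : g ^ (N / d + 1) = P :=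
    eq_of_eval_eq_on_nthRootsFinset hβ (by omega) (by omega) fun y hy => by
      rw [eval_pow, hPe y hy]
  rw [heq] at hdeg
  omega

open Polynomial in
/-- A permutation of the `a`-th roots of unity which, together with its inverse, preserves
the space spanned by `y, …, y ^ (δ - 1)` is a scaling. -/
theorem scaling_of_preserves_span {F : Type*} [Field F] {a r δ : ℕ} {β : F}
    (hβ : IsPrimitiveRoot β a) (har : a = r + δ - 1) (hδ : 2 ≤ δ) (hr : 2 ≤ r)
    {f g : F → F}
    (hf : ∀ y ∈ nthRootsFinset a (1 : F), f y ∈ nthRootsFinset a (1 : F))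
    (hg : ∀ y ∈ nthRootsFinset a (1 : F), g y ∈ nthRootsFinset a (1 : F))
    (hfg : ∀ y ∈ nthRootsFinset a (1 : F), f (g y) = y)
    (hgf : ∀ y ∈ nthRootsFinset a (1 : F), g (f y) = y)
    (hfS : ∀ t, 1 ≤ t → t ≤ δ - 1 → ∃ P : F[X], P.natDegree ≤ δ - 1 ∧ P.coeff 0 = 0 ∧
      ∀ y ∈ nthRootsFinset a (1 : F), f y ^ t = P.eval y)
    (hgS : ∀ t, 1 ≤ t → t ≤ δ - 1 → ∃ P : F[X], P.natDegree ≤ δ - 1 ∧ P.coeff 0 = 0 ∧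
      ∀ y ∈ nthRootsFinset a (1 : F), g y ^ t = P.eval y) :
    ∃ c : F, c ^ a = 1 ∧ ∀ y ∈ nthRootsFinset a (1 : F), f y = c * y := by
  classical
  have ha : 0 < a := by omega
  have : NeZero a := ⟨ha.ne'⟩
  have ha0 : (a : F) ≠ 0 := hβ.neZero'.out
  have hone : (1 : F) ∈ nthRootsFinset a (1 : F) := by rw [mem_nthRootsFinset ha, one_pow]
  have hzero : ∑ y ∈ nthRootsFinset a (1 : F), y = 0 := by
    have := sum_nthRootsFinset_pow_eq_zero hβ ha (e := 1)
      (fun h => by have := Nat.le_of_dvd one_pos h; omega)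
    simpa using this
  have hsumf : ∀ φ : F → F, ∑ y ∈ nthRootsFinset a (1 : F), φ (f y)
      = ∑ y ∈ nthRootsFinset a (1 : F), φ y := fun φ =>
    Finset.sum_nbij' f g hf hg hgf hfg fun _ _ => rfl
  have key : ∃ G : F[X], G.natDegree ≤ 1 ∧
      ∀ y ∈ nthRootsFinset a (1 : F), f y = G.eval y := by
    by_cases hsmall : 2 * (δ - 1) < a
    · obtain ⟨G, hG, -, hGe⟩ := hfS 1 le_rfl (by omega)
      simp only [pow_one] at hGe
      refine ⟨G, natDegree_le_one_of_pow_representable hβ hsmall hG fun j hj hj' => ?_, hGe⟩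
      obtain ⟨P, hP, -, hPe⟩ := hfS j hj hj'
      exact ⟨P, hP, fun y hy => by rw [← hGe y hy, hPe y hy]⟩
    -- Here `r ≤ δ - 1`, so `2 * (r - 1) < a`, and the orthogonal complement, spanned by `1, …, y ^
    -- (r - 1)`, is the small space. The coefficient of `f ^ j` at `k ≥ r` is a pairing with `y ^ (a
    -- - k)`; substituting `g` turns it into a pairing of `y ^ j` with a combination of `y, …, y ^
    -- (δ - 1)`. All exponents then lie strictly between `0` and `a`, so it vanishes.
    · have hrep : ∀ j, 1 ≤ j → j ≤ r - 1 → ∃ P : F[X], P.natDegree ≤ r - 1 ∧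
          ∀ y ∈ nthRootsFinset a (1 : F), f y ^ j = P.eval y := by
        intro j _ hj
        set P := Lagrange.interpolate (nthRootsFinset a (1 : F)) id (fun y => f y ^ j) with hPdef
        have hinj : Set.InjOn (id : F → F) (nthRootsFinset a (1 : F)) := Set.injOn_id _
        have hPe : ∀ y ∈ nthRootsFinset a (1 : F), f y ^ j = P.eval y := fun y hy =>
          (Lagrange.eval_interpolate_at_node (fun y => f y ^ j) hinj hy).symm
        have hPdeg : P.degree < a := by
          have := Lagrange.degree_interpolate_lt (fun y => f y ^ j) hinj
          rwa [hβ.card_nthRootsFinset] at this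
        have hPa : P.natDegree < a := by
          by_cases h0 : P = 0
          · simpa [h0] using ha
          · exact (natDegree_lt_iff_degree_lt h0).mpr hPdeg
        refine ⟨P, ?_, hPe⟩
        rw [natDegree_le_iff_coeff_eq_zero]
        intro k hk
        by_cases hka : a ≤ k
        · exact coeff_eq_zero_of_natDegree_lt (by omega)
        have hft := sum_nthRootsFinset_eval_mul_pow hβ ha hPa (t := a - k) (by omega) (by omega)
        rw [Nat.sub_sub_self (by omega)] at hft
        obtain ⟨Q, hQ, hQ0, hQe⟩ := hgS (a - k) (by omega) (by omega)
        have h1 : ∑ y ∈ nthRootsFinset a (1 : F), P.eval y * y ^ (a - k)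
            = ∑ y ∈ nthRootsFinset a (1 : F), (X ^ j * Q).eval y := by
          refine Eq.trans ?_ (hsumf fun y => (X ^ j * Q : F[X]).eval y)
          refine Finset.sum_congr rfl fun y hy => ?_
          rw [eval_mul, eval_pow, eval_X, ← hQe _ (hf y hy), hgf y hy, hPe y hy]
        have hdvd : ∀ s ∈ Finset.range δ,
            Q.coeff s * ∑ y ∈ nthRootsFinset a (1 : F), y ^ (j + s) = 0 := by
          intro s hs
          have hs' := Finset.mem_range.mp hs
          rcases Nat.eq_zero_or_pos s with rfl | hs0
          · rw [hQ0, zero_mul]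
          · rw [sum_nthRootsFinset_pow_eq_zero hβ ha, mul_zero]
            intro h
            have := Nat.le_of_dvd (by omega) h
            omega
        have h2 : ∑ y ∈ nthRootsFinset a (1 : F), (X ^ j * Q).eval y = 0 := by
          have h3 : ∀ y : F, (X ^ j * Q).eval y
              = ∑ s ∈ Finset.range δ, Q.coeff s * y ^ (j + s) := by
            intro y
            rw [eval_mul, eval_pow, eval_X, eval_eq_sum_range' (n := δ) (by omega),
              Finset.mul_sum]
            exact Finset.sum_congr rfl fun s _ => by ring
          simp_rw [h3]
          rw [Finset.sum_comm]
          simp_rw [← Finset.mul_sum]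
          exact Finset.sum_eq_zero hdvd
        rw [h1, h2] at hft
        exact (mul_eq_zero.mp hft.symm).resolve_left ha0
      obtain ⟨G, hG, hGe⟩ := hrep 1 le_rfl (by omega)
      simp only [pow_one] at hGe
      refine ⟨G, natDegree_le_one_of_pow_representable hβ (N := r - 1) (by omega) hG
        fun j hj hj' => ?_, hGe⟩
      obtain ⟨P, hP, hPe⟩ := hrep j hj hj'
      exact ⟨P, hP, fun y hy => by rw [← hGe y hy, hPe y hy]⟩
  obtain ⟨G, hG, hGe⟩ := key
  obtain ⟨A, B, rfl⟩ := exists_eq_X_add_C_of_natDegree_le_one hG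
  -- A permutation of the roots keeps their sum, which is `0`, while an affine map makes it `a * B`.
  have hB : B = 0 := by
    have h1 := hsumf fun y => y
    rw [hzero, Finset.sum_congr rfl hGe] at h1
    simp only [eval_add, eval_mul, eval_C, eval_X, Finset.sum_add_distrib, Finset.sum_const,
      hβ.card_nthRootsFinset, nsmul_eq_mul] at h1
    rw [← Finset.mul_sum, hzero, mul_zero, zero_add] at h1
    exact (mul_eq_zero.mp h1).resolve_left ha0
  subst hB
  have hlin : ∀ y ∈ nthRootsFinset a (1 : F), f y = A * y := fun y hy => by
    rw [hGe y hy]; simp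
  refine ⟨A, ?_, hlin⟩
  have := hf 1 hone
  rwa [hlin 1 hone, mul_one, mem_nthRootsFinset ha] at this

/-! ### Dual words of small weight and the repair groups. -/

/-- Coordinates on a set of positions: `blk` is the number of the repair group, and `Y` identifies
each repair group with the `a`-th roots of unity. -/
structure BlockCoords {F P : Type*} [Field F] {m : ℕ} (a : ℕ) (blk : P → Fin m) (Y : P → F) :
    Prop where
  pow_eq_one : ∀ p, Y p ^ a = 1
  ext : ∀ p p', blk p = blk p' → Y p = Y p' → p = p'
  exists_point : ∀ i z, z ^ a = 1 → ∃ p, blk p = i ∧ Y p = z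

open Polynomial in
/-- The restriction to one repair group of a word of the dual code, as a polynomial. -/
noncomputable def blockPoly {F : Type*} [Field F] (δ : ℕ) (A B : F) (q : F[X]) : F[X] :=
  C A + C B * X ^ δ + X * q

open Polynomial in
/-- The words of the dual code: the global parities contribute `A * μ i` and `B * y ^ δ`, and the
local parities contribute `y * q i y` on the `i`-th repair group. -/
def IsDualWord {F P : Type*} [Field F] {m : ℕ} (δ : ℕ) (μ : Fin m → F) (blk : P → Fin m)
    (Y : P → F) (w : P → F) : Prop :=
  ∃ (A B : F) (q : Fin m → F[X]), (∀ i, (q i).natDegree < δ - 1) ∧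
    ∀ p, w p = (blockPoly δ (A * μ (blk p)) B (q (blk p))).eval (Y p)

open Polynomial in
theorem natDegree_blockPoly_le {F : Type*} [Field F] {δ : ℕ} {A B : F} {q : F[X]}
    (hq : q.natDegree < δ - 1) : (blockPoly δ A B q).natDegree ≤ δ := by
  unfold blockPoly
  refine natDegree_add_le_of_degree_le (natDegree_add_le_of_degree_le (by simp)
    (natDegree_C_mul_X_pow_le B δ)) ?_
  exact natDegree_mul_le.trans (by rw [natDegree_X]; omega)

open Polynomial in
theorem natDegree_X_mul_le_of_lt {F : Type*} [Field F] {δ : ℕ} {q : F[X]}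
    (hq : q.natDegree < δ - 1) : (X * q).natDegree ≤ δ - 1 :=
  natDegree_mul_le.trans (by rw [natDegree_X]; omega)

open Polynomial in
theorem blockPoly_coeff_zero {F : Type*} [Field F] {δ : ℕ} (hδ : 2 ≤ δ) {A B : F} {q : F[X]} :
    (blockPoly δ A B q).coeff 0 = A := by
  have : 0 ≠ δ := by omega
  simp [blockPoly, coeff_X_pow, this]

open Polynomial in
theorem blockPoly_coeff_self {F : Type*} [Field F] {δ : ℕ} (hδ : 2 ≤ δ) {A B : F} {q : F[X]}
    (hq : q.natDegree < δ - 1) : (blockPoly δ A B q).coeff δ = B := by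
  obtain ⟨d, rfl⟩ : ∃ d, δ = d + 1 := ⟨δ - 1, by omega⟩
  simp only [blockPoly, coeff_add, coeff_C_mul, coeff_X_pow, coeff_X_mul, coeff_C]
  rw [coeff_eq_zero_of_natDegree_lt (by omega : q.natDegree < d)]
  simp

namespace BlockCoords

open Polynomial in
theorem mem_nthRootsFinset {F P : Type*} [Field F] {m a : ℕ} {blk : P → Fin m} {Y : P → F}
    (h : BlockCoords a blk Y) (ha : 0 < a) (p : P) : Y p ∈ nthRootsFinset a (1 : F) :=
  (Polynomial.mem_nthRootsFinset ha 1).mpr (h.pow_eq_one p)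

open Polynomial Classical in
theorem card_block {F P : Type*} [Field F] [Fintype P] {m a : ℕ} {blk : P → Fin m} {Y : P → F}
    (h : BlockCoords a blk Y) {β : F} (hβ : IsPrimitiveRoot β a) (ha : 0 < a) (i : Fin m) :
    (Finset.univ.filter fun p => blk p = i).card = a := by
  rw [← hβ.card_nthRootsFinset]
  refine Finset.card_bij (fun p _ => Y p) (fun p _ => h.mem_nthRootsFinset ha p) ?_ ?_
  · intro p hp p' hp' he
    simp only [Finset.mem_filter, Finset.mem_univ, true_and] at hp hp'
    exact h.ext p p' (hp.trans hp'.symm) he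
  · intro z hz
    obtain ⟨p, hp, hz⟩ := h.exists_point i z ((Polynomial.mem_nthRootsFinset ha 1).mp hz)
    exact ⟨p, by simpa using hp, hz⟩

-- `Y` is injective on a block, so the zeros of `w` there inject into the roots of `Q`.
open Polynomial Classical in
theorem le_card_ne_zero {F P : Type*} [Field F] [Fintype P] {m a : ℕ} {blk : P → Fin m}
    {Y : P → F} (h : BlockCoords a blk Y) {β : F} (hβ : IsPrimitiveRoot β a) (ha : 0 < a)
    (i : Fin m) {Q : F[X]} (hQ : Q ≠ 0) {d : ℕ} (hd : Q.natDegree ≤ d) {w : P → F}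
    (hw : ∀ p, blk p = i → w p = Q.eval (Y p)) :
    a - d ≤ (Finset.univ.filter fun p => blk p = i ∧ w p ≠ 0).card := by
  have hsplit := Finset.card_filter_add_card_filter_not
    (s := Finset.univ.filter fun p => blk p = i) (fun p => w p ≠ 0)
  rw [h.card_block hβ ha i, Finset.filter_filter, Finset.filter_filter] at hsplit
  have hz : (Finset.univ.filter fun p => blk p = i ∧ ¬ w p ≠ 0).card ≤ d := by
    calc (Finset.univ.filter fun p => blk p = i ∧ ¬ w p ≠ 0).card
        ≤ Q.roots.toFinset.card := by
          refine Finset.card_le_card_of_injOn Y ?_ ?_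
          · intro p hp
            simp only [Finset.coe_filter, Finset.mem_univ, true_and, not_not,
              Set.mem_ofPred_eq] at hp
            simp only [Finset.mem_coe, Multiset.mem_toFinset, mem_roots hQ, IsRoot.def]
            rw [← hw p hp.1, hp.2]
          · intro p hp p' hp' he
            simp only [Finset.coe_filter, Finset.mem_univ, true_and, not_not,
              Set.mem_ofPred_eq] at hp hp'
            exact h.ext p p' (hp.1.trans hp'.1.symm) he
      _ ≤ Q.roots.card := Multiset.toFinset_card_le _
      _ ≤ Q.natDegree := card_roots' Q
      _ ≤ d := hd
  omega

open Polynomial Classical in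
/-- The words of small weight of the dual code are supported on one repair group. -/
theorem blk_eq_of_card_support_le {F P : Type*} [Field F] [Fintype P] {m a r δ : ℕ}
    {blk : P → Fin m} {Y : P → F} (h : BlockCoords a blk Y) {β : F} (hβ : IsPrimitiveRoot β a)
    (har : a = r + δ - 1) (hδ : 2 ≤ δ) (hr : 3 ≤ r) (hmr : r + 1 < m * (r - 1))
    {μ : Fin m → F} (hμ : ∀ i, μ i ≠ 0) {w : P → F} (hw : IsDualWord δ μ blk Y w)
    (hcard : (Finset.univ.filter fun p => w p ≠ 0).card ≤ r + 1) {p p' : P}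
    (hp : w p ≠ 0) (hp' : w p' ≠ 0) : blk p = blk p' := by
  have ha : 0 < a := by omega
  obtain ⟨A, B, q, hq, hwq⟩ := hw
  by_cases hAB : A = 0 ∧ B = 0
  · obtain ⟨rfl, rfl⟩ := hAB
    have hwX : ∀ p, w p = (X * q (blk p)).eval (Y p) := fun p => by
      rw [hwq p]; simp [blockPoly]
    have hle : ∀ p, w p ≠ 0 →
        r ≤ (Finset.univ.filter fun p' => blk p' = blk p ∧ w p' ≠ 0).card := by
      intro p hp
      have hQ : X * q (blk p) ≠ 0 := by
        intro h0
        rw [hwX p, h0, eval_zero] at hp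
        exact hp rfl
      have := h.le_card_ne_zero hβ ha (blk p) hQ (natDegree_X_mul_le_of_lt (hq _)) (w := w)
        fun p' hp' => by rw [hwX p', hp']
      omega
    by_contra hne
    have hdisj : Disjoint (Finset.univ.filter fun x => blk x = blk p ∧ w x ≠ 0)
        (Finset.univ.filter fun x => blk x = blk p' ∧ w x ≠ 0) := by
      rw [Finset.disjoint_filter]
      rintro x - ⟨hx, -⟩ ⟨hx', -⟩
      exact hne (hx.symm.trans hx')
    have hsub : (Finset.univ.filter fun x => blk x = blk p ∧ w x ≠ 0) ∪
        (Finset.univ.filter fun x => blk x = blk p' ∧ w x ≠ 0)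
        ⊆ Finset.univ.filter fun p => w p ≠ 0 := by
      intro x hx
      simp only [Finset.mem_union, Finset.mem_filter, Finset.mem_univ, true_and] at hx ⊢
      exact hx.elim And.right And.right
    have h1 := Finset.card_le_card hsub
    rw [Finset.card_union_of_disjoint hdisj] at h1
    have h2 := hle p hp
    have h3 := hle p' hp'
    omega
  · exfalso
    -- A nonzero global part gives a nonzero polynomial of degree at most `δ` on every block, hence
    -- total weight at least `m * (r - 1)`.
    have hle : ∀ i : Fin m,
        r - 1 ≤ (Finset.univ.filter fun p => blk p = i ∧ w p ≠ 0).card := by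
      intro i
      have hQ : blockPoly δ (A * μ i) B (q i) ≠ 0 := by
        intro h0
        refine hAB ⟨?_, ?_⟩
        · have := blockPoly_coeff_zero hδ (A := A * μ i) (B := B) (q := q i)
          rw [h0, coeff_zero] at this
          exact (mul_eq_zero.mp this.symm).resolve_right (hμ i)
        · have := blockPoly_coeff_self hδ (A := A * μ i) (B := B) (hq i)
          rw [h0, coeff_zero] at this
          exact this.symm
      have := h.le_card_ne_zero hβ ha i hQ (natDegree_blockPoly_le (hq i)) (w := w)
        fun p' hp' => by rw [hwq p', hp']
      omega
    have hsum := Finset.card_eq_sum_card_fiberwise (f := blk)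
      (s := Finset.univ.filter fun p => w p ≠ 0) (t := Finset.univ) (by intro x _; simp)
    have h2 : m * (r - 1) ≤ (Finset.univ.filter fun p => w p ≠ 0).card := by
      rw [hsum]
      have h3 : ∀ i ∈ (Finset.univ : Finset (Fin m)), r - 1 ≤
          ((Finset.univ.filter fun p => w p ≠ 0).filter fun x => blk x = i).card := by
        intro i _
        rw [Finset.filter_filter]
        simp only [and_comm]
        exact hle i
      have := Finset.card_nsmul_le_sum _ _ _ h3
      simpa using this
    omega

open Polynomial Classical in
/-- Two positions of a repair group lie in the support of a dual word of minimum weight. -/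
theorem exists_dualWord_of_blk_eq {F P : Type*} [Field F] [Fintype P] {m a r δ : ℕ}
    {blk : P → Fin m} {Y : P → F} (h : BlockCoords a blk Y) {β : F} (hβ : IsPrimitiveRoot β a)
    (har : a = r + δ - 1) (hδ : 2 ≤ δ) (hr : 3 ≤ r)
    (μ : Fin m → F) {p p' : P} (hpp : blk p = blk p') :
    ∃ w, IsDualWord δ μ blk Y w ∧ (Finset.univ.filter fun x => w x ≠ 0).card ≤ r + 1 ∧
      w p ≠ 0 ∧ w p' ≠ 0 := by
  have ha : 0 < a := by omega
  have hY0 : ∀ x, Y x ≠ 0 := fun x hx => by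
    have := h.pow_eq_one x
    rw [hx, zero_pow ha.ne'] at this
    exact zero_ne_one this
  have hcardb := h.card_block hβ ha (blk p)
  have hpair : a - 2 ≤ ((Finset.univ.filter fun x => blk x = blk p) \ {p, p'}).card := by
    have h1 := Finset.le_card_sdiff {p, p'} (Finset.univ.filter fun x => blk x = blk p)
    have h2 : ({p, p'} : Finset P).card ≤ 2 := Finset.card_le_two
    omega
  -- Prescribing `δ - 2` zeros away from `p` and `p'` uses up the degree allowed for `q` and leaves
  -- `a - (δ - 2) = r + 1` positions.
  obtain ⟨Z, hZ, hZc⟩ := Finset.exists_subset_card_eq (n := δ - 2) (le_trans (by omega) hpair)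
  have hZb : ∀ z ∈ Z, blk z = blk p ∧ z ≠ p ∧ z ≠ p' := by
    intro z hz
    simpa using hZ hz
  set g : F[X] := ∏ z ∈ Z, (X - C (Y z)) with hg
  have hgdeg : g.natDegree = δ - 2 := by
    rw [hg, natDegree_prod_of_monic _ _ fun z _ => monic_X_sub_C _]
    simp [hZc]
  have hgz : ∀ x, blk x = blk p → (g.eval (Y x) = 0 ↔ x ∈ Z) := by
    intro x hx
    rw [hg, eval_prod, Finset.prod_eq_zero_iff]
    constructor
    · rintro ⟨z, hz, h0⟩
      rw [eval_sub, eval_X, eval_C, sub_eq_zero] at h0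
      rwa [h.ext x z (hx.trans (hZb z hz).1.symm) h0]
    · exact fun hxZ => ⟨x, hxZ, by simp⟩
  refine ⟨fun x => if blk x = blk p then Y x * g.eval (Y x) else 0,
    ⟨0, 0, fun i => if i = blk p then g else 0, ?_, ?_⟩, ?_, ?_, ?_⟩
  · intro i
    beta_reduce
    split_ifs
    · omega
    · rw [natDegree_zero]; omega
  · intro x
    by_cases hx : blk x = blk p <;> simp [blockPoly, hx]
  · have hsub : (Finset.univ.filter fun x =>
        (if blk x = blk p then Y x * g.eval (Y x) else 0) ≠ 0)
        ⊆ (Finset.univ.filter fun x => blk x = blk p) \ Z := by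
      intro x hx
      simp only [Finset.mem_filter, Finset.mem_univ, true_and, Finset.mem_sdiff] at hx ⊢
      by_cases hxb : blk x = blk p
      · refine ⟨hxb, fun hxZ => hx ?_⟩
        rw [if_pos hxb, (hgz x hxb).mpr hxZ, mul_zero]
      · exact absurd (if_neg hxb) hx
    refine (Finset.card_le_card hsub).trans ?_
    rw [Finset.card_sdiff_of_subset fun z hz => by simpa using (hZb z hz).1, hcardb, hZc]
    omega
  · beta_reduce
    rw [if_pos rfl]
    exact mul_ne_zero (hY0 p) fun h0 => (hZb p ((hgz p rfl).mp h0)).2.1 rfl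
  · beta_reduce
    rw [if_pos hpp.symm]
    exact mul_ne_zero (hY0 p') fun h0 => (hZb p' ((hgz p' hpp.symm).mp h0)).2.2 rfl

open Classical in
/-- A permutation whose inverse preserves the dual code permutes the repair groups. -/
theorem blk_map_eq {F P : Type*} [Field F] [Fintype P] {m a r δ : ℕ}
    {blk : P → Fin m} {Y : P → F} (h : BlockCoords a blk Y) {β : F} (hβ : IsPrimitiveRoot β a)
    (har : a = r + δ - 1) (hδ : 2 ≤ δ) (hr : 3 ≤ r) (hmr : r + 1 < m * (r - 1))
    {μ : Fin m → F} (hμ : ∀ i, μ i ≠ 0) {T : Equiv.Perm P}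
    (hT : ∀ w, IsDualWord δ μ blk Y w → IsDualWord δ μ blk Y (w ∘ T.symm)) {p p' : P}
    (hpp : blk p = blk p') : blk (T p) = blk (T p') := by
  obtain ⟨w, hw, hc, hp, hp'⟩ := h.exists_dualWord_of_blk_eq hβ har hδ hr μ hpp
  refine h.blk_eq_of_card_support_le hβ har hδ hr hmr hμ (hT w hw) ?_ (by simpa) (by simpa)
  refine le_trans (le_of_eq ?_) hc
  refine Finset.card_bij (fun x _ => T.symm x) ?_ ?_ ?_
  · intro x hx; simpa using hx
  · intro x _ y _ hxy; exact T.symm.injective hxy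
  · intro x hx; exact ⟨T x, by simpa using hx, by simp⟩

end BlockCoords

/-! ### Action of an automorphism inside the repair groups. -/

namespace BlockCoords

open Polynomial in
theorem poly_eq_of_eval_eq {F P : Type*} [Field F] {m a : ℕ} {blk : P → Fin m}
    {Y : P → F} (h : BlockCoords a blk Y) {β : F} (hβ : IsPrimitiveRoot β a) (ha : 0 < a)
    (i : Fin m) {Q R : F[X]} (hQ : Q.natDegree < a) (hR : R.natDegree < a)
    (hQR : ∀ p, blk p = i → Q.eval (Y p) = R.eval (Y p)) : Q = R := by
  refine eq_of_eval_eq_on_nthRootsFinset hβ hQ hR fun y hy => ?_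
  obtain ⟨p, hp, rfl⟩ := h.exists_point i y ((Polynomial.mem_nthRootsFinset ha 1).mp hy)
  exact hQR p hp

open Polynomial Classical in
/-- A map preserving the dual code and carrying the `i`-th repair group to the `i'`-th one pulls
local parities back to local parities. -/
theorem exists_poly_pow {F P : Type*} [Field F] {m a r δ : ℕ}
    {blk : P → Fin m} {Y : P → F} (h : BlockCoords a blk Y) {β : F} (hβ : IsPrimitiveRoot β a)
    (har : a = r + δ - 1) (hδ : 2 ≤ δ) (hr : 3 ≤ r) (hm : 2 ≤ m)
    {μ : Fin m → F} (hμ : ∀ i, μ i ≠ 0) {T : P → P}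
    (hT : ∀ w, IsDualWord δ μ blk Y w → IsDualWord δ μ blk Y (w ∘ T)) {i i' : Fin m}
    (hblk : ∀ p, blk (T p) = i' ↔ blk p = i) {t : ℕ} (ht : 1 ≤ t) (htδ : t ≤ δ - 1) :
    ∃ Q : F[X], Q.natDegree ≤ δ - 1 ∧ Q.coeff 0 = 0 ∧
      ∀ p, blk p = i → Y (T p) ^ t = Q.eval (Y p) := by
  have hw : IsDualWord δ μ blk Y fun p => if blk p = i' then Y p ^ t else 0 := by
    refine ⟨0, 0, fun j => if j = i' then X ^ (t - 1) else 0, fun j => ?_, fun p => ?_⟩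
    · beta_reduce
      split_ifs
      · rw [natDegree_X_pow]; omega
      · rw [natDegree_zero]; omega
    · obtain ⟨e, rfl⟩ : ∃ e, t = e + 1 := ⟨t - 1, by omega⟩
      by_cases hp : blk p = i' <;> simp [blockPoly, hp, pow_succ']
  obtain ⟨A, B, q, hq, hwq⟩ := hT _ hw
  have : Nontrivial (Fin m) := Fin.nontrivial_iff_two_le.mpr hm
  -- The pulled-back word vanishes on any other block `j`, which kills its global coefficients `A`
  -- and `B`.
  obtain ⟨j, hj⟩ := exists_ne i
  have h0 : blockPoly δ (A * μ j) B (q j) = 0 := by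
    refine h.poly_eq_of_eval_eq hβ (by omega) j
      ((natDegree_blockPoly_le (hq j)).trans_lt (by omega)) (by rw [natDegree_zero]; omega)
      fun p hp => ?_
    have h1 := hwq p
    rw [hp] at h1
    rw [← h1, eval_zero, Function.comp_apply, if_neg]
    rw [hblk, hp]
    exact hj
  have hA : A = 0 := by
    have := blockPoly_coeff_zero hδ (A := A * μ j) (B := B) (q := q j)
    rw [h0, coeff_zero] at this
    exact (mul_eq_zero.mp this.symm).resolve_right (hμ j)
  have hB : B = 0 := by
    have := blockPoly_coeff_self hδ (A := A * μ j) (B := B) (hq j)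
    rw [h0, coeff_zero] at this
    exact this.symm
  refine ⟨X * q i, natDegree_X_mul_le_of_lt (hq i), by simp, fun p hp => ?_⟩
  have h1 := hwq p
  rw [Function.comp_apply, if_pos ((hblk p).mpr hp), hp, hA, hB] at h1
  rw [h1]
  simp [blockPoly]

/-- An automorphism of the dual code acts on each repair group by a scaling. -/
theorem exists_scaling {F P : Type*} [Field F] {m a r δ : ℕ}
    {blk : P → Fin m} {Y : P → F} (h : BlockCoords a blk Y) {β : F} (hβ : IsPrimitiveRoot β a)
    (har : a = r + δ - 1) (hδ : 2 ≤ δ) (hr : 3 ≤ r) (hm : 2 ≤ m)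
    {μ : Fin m → F} (hμ : ∀ i, μ i ≠ 0) {T : Equiv.Perm P}
    (hT : ∀ w, IsDualWord δ μ blk Y w → IsDualWord δ μ blk Y (w ∘ T))
    (hT' : ∀ w, IsDualWord δ μ blk Y w → IsDualWord δ μ blk Y (w ∘ T.symm))
    (hblk : ∀ p p', blk p = blk p' ↔ blk (T p) = blk (T p')) (i : Fin m) :
    ∃ c : F, c ^ a = 1 ∧ ∀ p, blk p = i → Y (T p) = c * Y p := by
  have ha : 0 < a := by omega
  obtain ⟨p₀, hp₀, -⟩ := h.exists_point i 1 (one_pow a)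
  set i' := blk (T p₀) with hi'
  have hf : ∀ p, blk (T p) = i' ↔ blk p = i := fun p => by rw [hi', ← hblk, hp₀]
  have hg : ∀ p, blk (T.symm p) = i ↔ blk p = i' := fun p => by
    rw [← hf, Equiv.apply_symm_apply]
  have hex : ∀ j : Fin m, ∃ s : F → P, ∀ y ∈ Polynomial.nthRootsFinset a (1 : F),
      blk (s y) = j ∧ Y (s y) = y := by
    intro j
    have : ∀ y : F, ∃ p, y ∈ Polynomial.nthRootsFinset a (1 : F) → blk p = j ∧ Y p = y := by
      intro y
      by_cases hy : y ∈ Polynomial.nthRootsFinset a (1 : F)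
      · obtain ⟨p, hp⟩ := h.exists_point j y ((Polynomial.mem_nthRootsFinset ha 1).mp hy)
        exact ⟨p, fun _ => hp⟩
      · exact ⟨p₀, fun hy' => absurd hy' hy⟩
    choose s hs using this
    exact ⟨s, hs⟩
  obtain ⟨s, hs⟩ := hex i
  obtain ⟨s', hs'⟩ := hex i'
  have hss : ∀ p, blk p = i → s (Y p) = p := fun p hp => by
    obtain ⟨h1, h2⟩ := hs _ (h.mem_nthRootsFinset ha p)
    exact h.ext _ _ (h1.trans hp.symm) h2
  have hss' : ∀ p, blk p = i' → s' (Y p) = p := fun p hp => by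
    obtain ⟨h1, h2⟩ := hs' _ (h.mem_nthRootsFinset ha p)
    exact h.ext _ _ (h1.trans hp.symm) h2
  obtain ⟨c, hc, hlin⟩ := scaling_of_preserves_span hβ har hδ (by omega : 2 ≤ r)
    (f := fun y => Y (T (s y))) (g := fun y => Y (T.symm (s' y)))
    (fun y _ => h.mem_nthRootsFinset ha _) (fun y _ => h.mem_nthRootsFinset ha _)
    (fun y hy => by
      rw [hss _ ((hg _).mpr (hs' y hy).1), Equiv.apply_symm_apply, (hs' y hy).2])
    (fun y hy => by
      rw [hss' _ ((hf _).mpr (hs y hy).1), Equiv.symm_apply_apply, (hs y hy).2])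
    (fun t ht ht' => by
      obtain ⟨Q, h1, h2, h3⟩ := h.exists_poly_pow hβ har hδ hr hm hμ hT hf ht ht'
      refine ⟨Q, h1, h2, fun y hy => ?_⟩
      have := h3 (s y) (hs y hy).1
      rwa [(hs y hy).2] at this)
    (fun t ht ht' => by
      obtain ⟨Q, h1, h2, h3⟩ := h.exists_poly_pow hβ har hδ hr hm hμ hT' hg ht ht'
      refine ⟨Q, h1, h2, fun y hy => ?_⟩
      have := h3 (s' y) (hs' y hy).1
      rwa [(hs' y hy).2] at this)
  refine ⟨c, hc, fun p hp => ?_⟩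
  have := hlin (Y p) (h.mem_nthRootsFinset ha p)
  beta_reduce at this
  rwa [hss p hp] at this

open Polynomial in
/-- An automorphism of the dual code multiplies the second global parity by a constant. -/
theorem exists_scaling_pow {F P : Type*} [Field F] {m a r δ : ℕ}
    {blk : P → Fin m} {Y : P → F} (h : BlockCoords a blk Y) {β : F} (hβ : IsPrimitiveRoot β a)
    (har : a = r + δ - 1) (hδ : 2 ≤ δ) (hr : 3 ≤ r) (hm : 2 ≤ m)
    {μ : Fin m → F} (hμ : ∀ i, μ i ≠ 0) {T : Equiv.Perm P}
    (hT : ∀ w, IsDualWord δ μ blk Y w → IsDualWord δ μ blk Y (w ∘ T))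
    (hT' : ∀ w, IsDualWord δ μ blk Y w → IsDualWord δ μ blk Y (w ∘ T.symm))
    (hblk : ∀ p p', blk p = blk p' ↔ blk (T p) = blk (T p')) :
    ∃ c : F, c ^ a = 1 ∧ ∀ p, Y (T p) ^ δ = c ^ δ * Y p ^ δ := by
  choose c hc hlin using h.exists_scaling hβ har hδ hr hm hμ hT hT' hblk
  have hw : IsDualWord δ μ blk Y fun p => Y p ^ δ :=
    ⟨0, 1, 0, fun i => by simp only [Pi.zero_apply, natDegree_zero]; omega,
      fun p => by simp [blockPoly]⟩
  obtain ⟨A, B, q, hq, hwq⟩ := hT _ hw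
  -- The pulled-back word is `c i ^ δ * y ^ δ` on block `i`, and its coefficient at `y ^ δ` is the
  -- global `B`.
  have hB : ∀ i, c i ^ δ = B := by
    intro i
    have heq : C (c i ^ δ) * X ^ δ = blockPoly δ (A * μ i) B (q i) := by
      refine h.poly_eq_of_eval_eq hβ (by omega) i
        ((natDegree_C_mul_X_pow_le _ δ).trans_lt (by omega))
        ((natDegree_blockPoly_le (hq i)).trans_lt (by omega)) fun p hp => ?_
      have h1 := hwq p
      rw [Function.comp_apply, hp, hlin i p hp] at h1
      rw [← h1]
      simp [mul_pow]
    rw [← blockPoly_coeff_self hδ (A := A * μ i) (B := B) (hq i), ← heq, coeff_C_mul,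
      coeff_X_pow_self, mul_one]
  refine ⟨c ⟨0, by omega⟩, hc _, fun p => ?_⟩
  rw [hlin _ p rfl, mul_pow, hB, hB]

end BlockCoords

/-! ### The regular cyclic action and the divisibility. -/

/-- Translation by `k` in the numbering `l` of the coordinates. -/
def shiftPerm {n : ℕ} (l : Equiv.Perm (ZMod n)) (k : ZMod n) : Equiv.Perm (ZMod n) :=
  (l.symm.trans (Equiv.addRight k)).trans l

theorem shiftPerm_apply {n : ℕ} (l : Equiv.Perm (ZMod n)) (k p : ZMod n) :
    shiftPerm l k p = l (l.symm p + k) := rfl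

theorem shiftPerm_symm {n : ℕ} (l : Equiv.Perm (ZMod n)) (k : ZMod n) :
    (shiftPerm l k).symm = shiftPerm l (-k) := by
  ext p
  rw [Equiv.symm_apply_eq]
  simp [shiftPerm_apply]

theorem shiftPerm_add_apply {n : ℕ} (l : Equiv.Perm (ZMod n)) (j k p : ZMod n) :
    shiftPerm l (j + k) p = shiftPerm l j (shiftPerm l k p) := by
  simp [shiftPerm_apply, add_assoc, add_comm]

theorem shiftPerm_zero_apply {n : ℕ} (l : Equiv.Perm (ZMod n)) (p : ZMod n) :
    shiftPerm l 0 p = p := by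
  simp [shiftPerm_apply]

namespace BlockCoords

-- The shifts returning `p` to its own block form a subgroup; by regularity they correspond to the
-- positions of that block, so the order is `a` and Lagrange applies.
open Classical in
theorem nsmul_eq_zero_of_blk_shiftPerm {F : Type*} [Field F] {n m a : ℕ} [NeZero n]
    {blk : ZMod n → Fin m} {Y : ZMod n → F} (h : BlockCoords a blk Y) {β : F}
    (hβ : IsPrimitiveRoot β a) (ha : 0 < a) {l : Equiv.Perm (ZMod n)}
    (hblk : ∀ k p p', blk p = blk p' → blk (shiftPerm l k p) = blk (shiftPerm l k p'))
    {p : ZMod n} {k : ZMod n} (hk : blk (shiftPerm l k p) = blk p) : a • k = 0 := by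
  let H : AddSubgroup (ZMod n) :=
    { carrier := {j | blk (shiftPerm l j p) = blk p}
      zero_mem' := by simp [shiftPerm_zero_apply]
      add_mem' := by
        intro x y hx hy
        change blk (shiftPerm l (x + y) p) = blk p
        rw [shiftPerm_add_apply]
        exact (hblk x _ _ hy).trans hx
      neg_mem' := by
        intro x hx
        change blk (shiftPerm l (-x) p) = blk p
        have := hblk (-x) _ _ hx
        rw [← shiftPerm_add_apply, neg_add_cancel, shiftPerm_zero_apply] at this
        exact this.symm }
  have hH : Nat.card H = a := by
    rw [← h.card_block hβ ha (blk p), ← Fintype.card_coe, ← Nat.card_eq_fintype_card]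
    refine Nat.card_congr (((Equiv.addLeft (l.symm p)).trans l).subtypeEquiv fun j => ?_)
    rw [Finset.mem_filter]
    exact ⟨fun hj => ⟨Finset.mem_univ _, hj⟩, And.right⟩
  have hkH : k ∈ H := hk
  have := card_nsmul_eq_zero' (x := (⟨k, hkH⟩ : H))
  rw [hH] at this
  exact congrArg Subtype.val this

/-- If the dual code is invariant under a cyclic regular group of coordinate permutations, then
`gcd(m, a)` divides `δ`. -/
theorem gcd_dvd_of_shift_invariant {F : Type*} [Field F] {n m a r δ : ℕ} [NeZero n]
    {blk : ZMod n → Fin m} {Y : ZMod n → F} (h : BlockCoords a blk Y) {β : F}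
    (hβ : IsPrimitiveRoot β a) (hn : n = m * a) (har : a = r + δ - 1) (hδ : 2 ≤ δ) (hr : 3 ≤ r)
    (hm : 2 ≤ m) (hmr : r + 1 < m * (r - 1)) {μ : Fin m → F} (hμ : ∀ i, μ i ≠ 0)
    {l : Equiv.Perm (ZMod n)}
    (hl : ∀ k w, IsDualWord δ μ blk Y w → IsDualWord δ μ blk Y (w ∘ shiftPerm l k)) :
    Nat.gcd m a ∣ δ := by
  have ha : 0 < a := by omega
  have hblk : ∀ k p p', blk p = blk p' → blk (shiftPerm l k p) = blk (shiftPerm l k p') :=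
    fun k p p' hpp => h.blk_map_eq hβ har hδ hr hmr hμ
      (by rw [shiftPerm_symm]; exact hl (-k)) hpp
  have hblk' : ∀ p p', blk p = blk p' ↔ blk (shiftPerm l 1 p) = blk (shiftPerm l 1 p') :=
    fun p p' => ⟨hblk 1 p p', fun hpp => by
      have := hblk (-1) _ _ hpp
      rwa [← shiftPerm_add_apply, ← shiftPerm_add_apply, neg_add_cancel, shiftPerm_zero_apply,
        shiftPerm_zero_apply] at this⟩
  obtain ⟨c, hc, hcY⟩ := h.exists_scaling_pow hβ har hδ hr hm hμ (hl 1)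
    (by rw [shiftPerm_symm]; exact hl (-1)) hblk'
  have hiter : ∀ (j : ℕ) (p : ZMod n), Y (shiftPerm l j p) ^ δ = (c ^ δ) ^ j * Y p ^ δ := by
    intro j p
    induction j with
    | zero => simp [shiftPerm_zero_apply]
    | succ j ih =>
      rw [Nat.cast_succ, add_comm (j : ZMod n), shiftPerm_add_apply, hcY, ih, pow_succ']
      ring
  obtain ⟨p₀, hp₀, hY₀⟩ := h.exists_point ⟨0, by omega⟩ 1 (one_pow a)
  obtain ⟨p₁, hp₁, hY₁⟩ := h.exists_point ⟨0, by omega⟩ β hβ.pow_eq_one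
  have hk : shiftPerm l (l.symm p₁ - l.symm p₀) p₀ = p₁ := by simp [shiftPerm_apply]
  set k := l.symm p₁ - l.symm p₀
  have hak : a • k = 0 :=
    h.nsmul_eq_zero_of_blk_shiftPerm hβ ha hblk (p := p₀) (by rw [hk, hp₀, hp₁])
  have hmk : m ∣ k.val := by
    have h1 : ((a * k.val : ℕ) : ZMod n) = 0 := by
      rw [Nat.cast_mul, ZMod.natCast_zmod_val, ← nsmul_eq_mul, hak]
    rw [ZMod.natCast_eq_zero_iff] at h1
    refine Nat.dvd_of_mul_dvd_mul_left ha (dvd_trans ?_ h1)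
    rw [hn, mul_comm]
  have hpow := hiter k.val p₀
  rw [ZMod.natCast_zmod_val, hk, hY₀, hY₁, one_pow, mul_one] at hpow
  have : NeZero a := ⟨ha.ne'⟩
  obtain ⟨e, -, rfl⟩ := hβ.eq_pow_of_pow_eq_one hc
  obtain ⟨a', ha'⟩ := Nat.gcd_dvd_right m a
  obtain ⟨k', hk'⟩ := (Nat.gcd_dvd_left m a).trans hmk
  have ha'0 : 0 < a' := Nat.pos_of_ne_zero fun h0 => by rw [h0, mul_zero] at ha'; omega
  -- With `a = g * a'` and `k = g * k'`, where `g = gcd(m, a)`, the exponent `e * δ * k * a'` is a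
  -- multiple of `a`.
  have h1 : β ^ (δ * a') = 1 := by
    rw [pow_mul, hpow, ← pow_mul, ← pow_mul, ← pow_mul, hβ.pow_eq_one_iff_dvd, hk']
    refine ⟨e * δ * k', ?_⟩
    conv_rhs => rw [ha']
    ring
  rw [hβ.pow_eq_one_iff_dvd] at h1
  refine Nat.dvd_of_mul_dvd_mul_right ha'0 (dvd_trans ?_ h1)
  rw [← ha']

end BlockCoords

/-! ### From the parity-check matrix to dual words and shifts. -/

namespace MRCode

theorem mem_code_iff {F : Type*} [Field F] {n m δ s : ℕ} [NeZero n] {α : F} {c : ZMod n → F} :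
    c ∈ code n m δ s α ↔ ∀ i, ∑ p, parityCheck n m δ s α i p * c p = 0 := by
  rw [code, LinearMap.mem_ker, Matrix.mulVecLin_apply, funext_iff]
  rfl

/-- The words orthogonal to the code are the combinations of the parity checks. -/
theorem annihilates_code_iff {F : Type*} [Field F] {n m δ s : ℕ} [NeZero n] {α : F}
    {w : ZMod n → F} :
    (∀ c ∈ code n m δ s α, ∑ p, w p * c p = 0) ↔
      ∃ d : (Fin m × Fin (δ - 1)) ⊕ Fin 2 → F, ∀ p, w p = ∑ i, d i * parityCheck n m δ s α i p := by
  constructor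
  · intro h
    let Lf : (ZMod n → F) → Module.Dual F (ZMod n → F) := fun v => ∑ p, v p • LinearMap.proj p
    have hLf : ∀ v c, Lf v c = ∑ p, v p * c p := fun v c => by simp [Lf]
    -- A functional vanishing on the common kernel of finitely many functionals lies in their span.
    have hmem : Lf w ∈ Submodule.span F (Set.range fun i => Lf (parityCheck n m δ s α i)) := by
      refine mem_span_of_iInf_ker_le_ker fun c hc => ?_
      rw [LinearMap.mem_ker, hLf]
      refine h c (mem_code_iff.mpr fun i => ?_)
      rw [← hLf]
      exact (Submodule.mem_iInf _).mp hc i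
    obtain ⟨d, hd⟩ := (Submodule.mem_span_range_iff_exists_fun F).mp hmem
    refine ⟨d, fun p => ?_⟩
    have := LinearMap.congr_fun hd (Pi.single p 1)
    simpa [hLf, Pi.single_apply] using this.symm
  · rintro ⟨d, hd⟩ c hc
    simp_rw [hd, Finset.sum_mul]
    rw [Finset.sum_comm]
    refine Finset.sum_eq_zero fun i _ => ?_
    simp_rw [mul_assoc]
    rw [← Finset.mul_sum, mem_code_iff.mp hc i, mul_zero]

-- The multiplier of local row `t` is the coefficient of `q i` at `X ^ t`; the factor `X` in
-- `blockPoly` accounts for the row exponent `t + 1`.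
open Polynomial in
theorem isDualWord_iff_exists {F : Type*} [Field F] {n m δ s : ℕ} (hδ : 2 ≤ δ)
    (hm : 0 < m) {α : F} {w : ZMod n → F} :
    IsDualWord δ (fun i : Fin m => (α ^ s) ^ (i : ℕ))
        (fun p : ZMod n => ⟨p.val % m, Nat.mod_lt _ hm⟩) (fun p => (α ^ m) ^ (p.val / m)) w ↔
      ∃ d : (Fin m × Fin (δ - 1)) ⊕ Fin 2 → F, ∀ p, w p = ∑ i, d i * parityCheck n m δ s α i p := by
  have hsum : ∀ (d : (Fin m × Fin (δ - 1)) ⊕ Fin 2 → F) (p : ZMod n),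
      ∑ i, d i * parityCheck n m δ s α i p
        = (∑ t : Fin (δ - 1), d (Sum.inl (⟨p.val % m, Nat.mod_lt _ hm⟩, t))
            * (α ^ m) ^ ((t.val + 1) * (p.val / m)))
          + (d (Sum.inr 0) * (α ^ s) ^ (p.val % m)
            + d (Sum.inr 1) * (α ^ m) ^ (δ * (p.val / m))) := by
    intro d p
    rw [Fintype.sum_sum_type, Fin.sum_univ_two, Fintype.sum_prod_type,
      Finset.sum_eq_single ⟨p.val % m, Nat.mod_lt _ hm⟩]
    · simp [parityCheck]
    · intro i _ hi
      refine Finset.sum_eq_zero fun t _ => ?_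
      have : p.val % m ≠ i.val := fun h => hi (Fin.ext h.symm)
      simp [parityCheck, this]
    · intro h; exact absurd (Finset.mem_univ _) h
  constructor
  · rintro ⟨A, B, q, hq, hw⟩
    refine ⟨Sum.elim (fun it => (q it.1).coeff it.2) ![A, B], fun p => ?_⟩
    rw [hsum, hw p]
    simp only [blockPoly, eval_add, eval_C, eval_mul, eval_pow, eval_X, Sum.elim_inl,
      Sum.elim_inr, Matrix.cons_val_zero, Matrix.cons_val_one]
    rw [eval_eq_sum_range' (hq _), Finset.mul_sum, Finset.sum_range, add_comm]
    refine congrArg₂ _ (Finset.sum_congr rfl fun t _ => ?_) ?_ <;> ring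
  · rintro ⟨d, hd⟩
    refine ⟨d (Sum.inr 0), d (Sum.inr 1),
      fun i => ∑ t : Fin (δ - 1), C (d (Sum.inl (i, t))) * X ^ t.val, fun i => ?_, fun p => ?_⟩
    · refine lt_of_le_of_lt (natDegree_sum_le_of_forall_le (n := δ - 2) _ _ fun t _ =>
        (natDegree_C_mul_X_pow_le _ _).trans ?_) (by omega)
      have := t.isLt
      omega
    · rw [hd p, hsum]
      simp only [blockPoly, eval_add, eval_C, eval_mul, eval_pow, eval_X, eval_finsetSum,
        Finset.mul_sum]
      rw [add_comm]
      refine congrArg₂ _ ?_ (Finset.sum_congr rfl fun t _ => ?_) <;> ring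

theorem blockCoords {F : Type*} [Field F] {n m a : ℕ} [NeZero n] (hm : 0 < m) (hn : n = m * a)
    {α : F} (hα : IsPrimitiveRoot α n) :
    BlockCoords a (fun p : ZMod n => (⟨p.val % m, Nat.mod_lt _ hm⟩ : Fin m))
      (fun p => (α ^ m) ^ (p.val / m)) := by
  have hn0 : 0 < n := Nat.pos_of_ne_zero (NeZero.ne n)
  have hβ : IsPrimitiveRoot (α ^ m) a := hα.pow hn0 hn
  have ha : 0 < a := Nat.pos_of_ne_zero fun h => by rw [h, mul_zero] at hn; omega
  refine ⟨fun p => ?_, fun p p' hpp hY => ?_, fun i z hz => ?_⟩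
  · rw [← pow_mul, mul_comm, pow_mul, hβ.pow_eq_one, one_pow]
  · have hlt : ∀ p : ZMod n, p.val / m < a := fun p =>
      Nat.div_lt_of_lt_mul (lt_of_lt_of_eq p.val_lt hn)
    have h1 := hβ.pow_inj (hlt p) (hlt p') hY
    have h2 : p.val % m = p'.val % m := congrArg Fin.val hpp
    refine ZMod.val_injective n ?_
    rw [← Nat.mod_add_div p.val m, ← Nat.mod_add_div p'.val m, h1, h2]
  · have : NeZero a := ⟨ha.ne'⟩
    obtain ⟨x, hx, rfl⟩ := hβ.eq_pow_of_pow_eq_one hz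
    have hlt : i.val + m * x < n := by
      rw [hn]
      calc i.val + m * x < m + m * x := Nat.add_lt_add_right i.isLt _
        _ = m * (x + 1) := by ring
        _ ≤ m * a := Nat.mul_le_mul_left m hx
    refine ⟨((i.val + m * x : ℕ) : ZMod n), Fin.ext ?_, ?_⟩
    · change ((i.val + m * x : ℕ) : ZMod n).val % m = i.val
      rw [ZMod.val_natCast, Nat.mod_eq_of_lt hlt, Nat.add_mul_mod_self_left,
        Nat.mod_eq_of_lt i.isLt]
    · rw [ZMod.val_natCast, Nat.mod_eq_of_lt hlt, Nat.add_mul_div_left _ _ hm,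
        Nat.div_eq_of_lt i.isLt, zero_add]

/-- Every cyclic shift in the new numbering preserves the code. -/
theorem comp_shiftPerm_mem {F : Type*} [Field F] {n : ℕ} [NeZero n]
    {C : Submodule F (ZMod n → F)} {l : Equiv.Perm (ZMod n)} (h : IsCyclicCode (permute C l))
    (k : ZMod n) {c : ZMod n → F} (hc : c ∈ C) : c ∘ shiftPerm l k ∈ C := by
  have hstep : ∀ c ∈ C, c ∘ shiftPerm l (-1) ∈ C := by
    intro c hc
    obtain ⟨c', hc', he⟩ := h (c ∘ l) ⟨c, hc, rfl⟩
    have : c ∘ shiftPerm l (-1) = c' := by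
      funext p
      have := congrFun he (l.symm p)
      simp only [LinearMap.funLeft_apply, Equiv.apply_symm_apply, Function.comp_apply] at this
      rw [this, Function.comp_apply, shiftPerm_apply, sub_eq_add_neg]
    rwa [this]
  have hiter : ∀ j : ℕ, c ∘ shiftPerm l (-(j : ZMod n)) ∈ C := by
    intro j
    induction j with
    | zero =>
      have : c ∘ shiftPerm l (-((0 : ℕ) : ZMod n)) = c := by
        funext p
        simp [shiftPerm_zero_apply]
      rwa [this]
    | succ j ih =>
      have : c ∘ shiftPerm l (-((j + 1 : ℕ) : ZMod n))
          = (c ∘ shiftPerm l (-(j : ZMod n))) ∘ shiftPerm l (-1) := by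
        funext p
        simp only [Function.comp_apply, ← shiftPerm_add_apply]
        rw [Nat.cast_succ, neg_add]
      rw [this]
      exact hstep _ ih
  have := hiter (-k).val
  rwa [ZMod.natCast_zmod_val, neg_neg] at this

/-- Permuting `w` is adjoint to permuting `c` by the inverse shift. -/
theorem annihilates_comp_shiftPerm {F : Type*} [Field F] {n : ℕ} [NeZero n]
    {C : Submodule F (ZMod n → F)} {l : Equiv.Perm (ZMod n)} (h : IsCyclicCode (permute C l))
    (k : ZMod n) {w : ZMod n → F} (hw : ∀ c ∈ C, ∑ p, w p * c p = 0) :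
    ∀ c ∈ C, ∑ p, (w ∘ shiftPerm l k) p * c p = 0 := by
  intro c hc
  rw [← hw _ (comp_shiftPerm_mem h (-k) hc)]
  refine Fintype.sum_equiv (shiftPerm l k) _ _ fun p => ?_
  simp only [Function.comp_apply, ← shiftPerm_add_apply, neg_add_cancel, shiftPerm_zero_apply]

end MRCode

theorem mainTheorem11 {F : Type*} [Field F] [Fintype F]
    (q b b' n a m r δ s u v : ℕ) [NeZero n] (α : F)
    (hq : IsPrimePow q) (hF : Fintype.card F = q ^ b)
    (hn : n = q ^ b - 1) (hα : IsPrimitiveRoot α n)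
    (ha : a = r + δ - 1) (hab : a = q ^ b' - 1) (han : a ∣ n)
    (hm : m = n / a) (hs : Nat.gcd s m = 1)
    (hk : Module.finrank F (MRCode.code n m δ s α) = u * r + v)
    (hv0 : 0 < v) (hvr : v ≤ r) (hu : 2 * (r - v + 1) ≤ u)
    (hφ : a = 4 ∨ Nat.gcd a (Nat.totient a) = 1)
    (hcase : (4 ≤ δ ∧ 5 ≤ r) ∨ (δ = 3 ∧ 4 ≤ r) ∨ (δ = 2 ∧ 3 ≤ r ∧ Odd r))
    (hcyc : ∃ l : Equiv.Perm (ZMod n),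
      MRCode.IsCyclicCode (MRCode.permute (MRCode.code n m δ s α) l)) :
    Nat.gcd m a ∣ δ := by
  obtain ⟨l, hl⟩ := hcyc
  have hn0 : 0 < n := Nat.pos_of_ne_zero (NeZero.ne n)
  have hnm : n = m * a := by rw [hm, Nat.div_mul_cancel han]
  have hm0 : 0 < m := Nat.pos_of_ne_zero fun h => by rw [h, zero_mul] at hnm; omega
  -- For `m ≥ 2` the weight bound `r + 1 < m * (r - 1)` fails only at `m = 2`, `r = 3`. That forces
  -- `δ = 2`, where `gcd(m, a) ∣ 2` is immediate.
  rcases (by omega : m = 1 ∨ (m = 2 ∧ δ = 2) ∨ (2 ≤ m ∧ (3 ≤ m ∨ 4 ≤ r)))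
    with hm1 | ⟨hm2, hδ⟩ | ⟨hm2, hmr⟩
  · rw [hm1, Nat.gcd_one_left]; exact one_dvd δ
  · rw [hδ]
    exact (Nat.gcd_dvd_left m a).trans (by rw [hm2])
  have hweight : r + 1 < m * (r - 1) := by
    rcases hmr with hm3 | hr4
    · have := Nat.mul_le_mul_right (r - 1) hm3
      omega
    · have := Nat.mul_le_mul_right (r - 1) hm2
      omega
  have hα0 : α ≠ 0 := hα.ne_zero hn0.ne'
  refine (MRCode.blockCoords hm0 hnm hα).gcd_dvd_of_shift_invariant (hα.pow hn0 hnm) hnm ha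
    (by omega) (by omega) hm2 hweight (μ := fun i : Fin m => (α ^ s) ^ (i : ℕ))
    (fun i => pow_ne_zero _ (pow_ne_zero _ hα0)) (l := l) fun k w hw => ?_
  rw [MRCode.isDualWord_iff_exists (by omega) hm0, ← MRCode.annihilates_code_iff] at hw ⊢
  exact MRCode.annihilates_comp_shiftPerm hl k hw
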